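/- \textbf{ACD computation.} Let $G=(V,E)$ be a graph with $n$ nodes and maximum degree $\Delta$. For $\gamma>0$, nodes $u,v$ are \emph{$\gamma$-friends} if $\{u,v\}\in E$ and $|N(u)\cap N(v)|\ge(1-\gamma)\Delta$; a node is \emph{$\gamma$-dense} if it has at least $(1-\gamma)\Delta$ $\gamma$-friends. A partition $V=V_{sparse}\cup C_1\cup\dots\cup C_k$ is an \emph{$(\varepsilon,\eta)$-almost-clique decomposition} (ACD) of $G$ if (1) $V_{sparse}$ contains no $\eta$-dense node; (2) $(1-\varepsilon)\Delta\le|C_i|\le(1+\varepsilon)\Delta$ for every $i$; (3) $|N(v)\cap C_i|\ge(1-\varepsilon)\Delta$ for every $i$ and every $v\in C_i$. An algorithm \emph{computes} an ACD if, at its end, every node of $V_{sparse}$ knows that it is in $V_{sparse}$, and every node of $C_i$ knows an AC-ID of $C_i$, where distinct $C_i$ have distinct AC-IDs. In the CONGEST model, the nodes of $G$ have distinct identifiers smaller than $n^{a}$, for a constant $a$. Each node initially knows $n$, $\Delta$, its identifier and its degree, and has private independent random bits. Computation proceeds in synchronous rounds. In each round every node may send a message of $O(\log n)$ bits (with a constant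 that may depend on $a$) over each of its incident edges, and local computation is free. \textbf{Lemma.} Let $\varepsilon=1/3$ and $\eta=\varepsilon/108$. There is an absolute constant $T$ such that for every $a$ there is a randomized $T$-round CONGEST algorithm with the following property. For every constant $\kappa\ge1$ there is a constant $c>0$ such that, on every $n$-node graph $G$ with maximum degree $\Delta\ge c\log^2 n$, the algorithm computes an $(\varepsilon,\eta)$-almost-clique decomposition of $G$ with probability at least $1-n^{-\kappa}$. -/

import Mathlib

open Finset

/-! ### Almost-clique decompositions -/

section AlmostCliques

variable {V : Type} [Fintype V] [DecidableEq V] (G : SimpleGraph V) [DecidableRel G.Adj]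

/-- `u` and `v` are `ε`-similar: they have at least `(1 - ε)Δ` common neighbours. -/
def IsSimilar (ε : ℝ) (u v : V) : Prop :=
  (1 - ε) * (G.maxDegree : ℝ) ≤ ((G.neighborFinset u ∩ G.neighborFinset v).card : ℝ)

/-- `u` and `v` are `ε`-friends: adjacent and `ε`-similar. -/
def IsFriend (ε : ℝ) (u v : V) : Prop :=
  G.Adj u v ∧ IsSimilar G ε u v

open Classical in
/-- `u` is `ε`-dense: it has at least `(1 - ε)Δ` `ε`-friends. -/
def IsDense (ε : ℝ) (u : V) : Prop :=
  (1 - ε) * (G.maxDegree : ℝ) ≤ ((univ.filter fun v => IsFriend G ε u v).card : ℝ)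

/-- `V = sparse ∪ C 0 ∪ ⋯ ∪ C (k - 1)` is an `(ε, η)`-almost-clique decomposition of `G`. -/
structure IsACD (ε η : ℝ) (sparse : Finset V) {k : ℕ} (C : Fin k → Finset V) : Prop where
  cover : ∀ v, v ∈ sparse ∨ ∃ i, v ∈ C i
  disjoint_sparse : ∀ i, Disjoint sparse (C i)
  disjoint : ∀ i j, i ≠ j → Disjoint (C i) (C j)
  not_dense : ∀ v ∈ sparse, ¬ IsDense G η v
  le_card : ∀ i, (1 - ε) * (G.maxDegree : ℝ) ≤ ((C i).card : ℝ)
  card_le : ∀ i, ((C i).card : ℝ) ≤ (1 + ε) * (G.maxDegree : ℝ)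
  le_card_neighbors : ∀ i, ∀ v ∈ C i,
    (1 - ε) * (G.maxDegree : ℝ) ≤ ((G.neighborFinset v ∩ C i).card : ℝ)

/-- The node outputs `out` describe an `(ε, η)`-almost-clique decomposition: a node of the sparse
part outputs `none`, and a node of `C i` outputs `some` of the AC-ID of `C i`, where distinct
almost-cliques have distinct AC-IDs. -/
def OutputsACD (ε η : ℝ) (out : V → Option ℕ) : Prop :=
  ∃ (sparse : Finset V) (k : ℕ) (C : Fin k → Finset V) (acId : Fin k → ℕ),
    IsACD G ε η sparse C ∧ Function.Injective acId ∧
    (∀ v ∈ sparse, out v = none) ∧ (∀ i, ∀ v ∈ C i, out v = some (acId i))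

end AlmostCliques

/-! ### Synchronous message passing -/

/-- How a network presents itself to its nodes: distinct identifiers below `idBound`, and an
arbitrary numbering by `0, …, deg v - 1` of the edges at each node `v` (its ports). -/
structure Labelling {V : Type} [Fintype V] [DecidableEq V] (G : SimpleGraph V)
    [DecidableRel G.Adj] (idBound : ℕ) where
  ident : V → ℕ
  ident_injective : Function.Injective ident
  ident_lt : ∀ v, ident v < idBound
  port : ∀ v, G.neighborSet v ≃ Fin (G.degree v)

/-- A randomized distributed algorithm, the same at every node. A node starts from the number of
nodes `n`, the maximum degree `Δ`, its own identifier, its own degree, and `numBits n Δ` private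
random bits. In each round it sends a bit string through each of its ports (the empty string means
that nothing is sent), and updates its state from the strings that arrive on its ports.
Local computation is unrestricted. -/
structure DistAlgorithm where
  State : Type
  numBits : ℕ → ℕ → ℕ
  init : (n Δ ident degree : ℕ) → (Fin (numBits n Δ) → Bool) → State
  send : State → (port : ℕ) → List Bool
  receive : State → (port : ℕ → List Bool) → State
  output : State → Option ℕ

namespace DistAlgorithm

variable (A : DistAlgorithm) {V : Type} [Fintype V] [DecidableEq V] (G : SimpleGraph V)
  [DecidableRel G.Adj]

/-- The private random bits of all the nodes. -/
abbrev Coins : Type :=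
  V → Fin (A.numBits (Fintype.card V) G.maxDegree) → Bool

variable {G} {idBound : ℕ} (L : Labelling G idBound)

/-- What node `v` receives, by port, when all nodes send according to the states `s`. -/
def inbox (s : V → A.State) (v : V) (p : ℕ) : List Bool :=
  if h : p < G.degree v then
    let u := (L.port v).symm ⟨p, h⟩
    A.send (s u.1) (L.port u.1 ⟨v, G.adj_symm u.2⟩)
  else []

/-- The states of all nodes after `t` rounds, as a function of the random bits. -/
def run (ω : A.Coins G) : ℕ → V → A.State
  | 0 => fun v => A.init (Fintype.card V) G.maxDegree (L.ident v) (G.degree v) (ω v)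
  | t + 1 => fun v => A.receive (run ω t v) (A.inbox L (run ω t) v)

/-- The probability, over independent fair random bits, that the outputs after `T` rounds
satisfy `P`. -/
noncomputable def outputProb (T : ℕ) (P : (V → Option ℕ) → Prop) : ℝ :=
  (ProbabilityTheory.uniformOn (Set.univ : Set (A.Coins G))).real
    {ω | P fun v => A.output (A.run L ω T v)}

/-- The CONGEST restriction, for `T` rounds in networks whose identifiers are below `n ^ a`:
in every execution, every message has at most `B * ⌈log₂ n⌉` bits. -/
def IsCongest (T a B : ℕ) : Prop :=
  ∀ (V : Type) [Fintype V] [DecidableEq V] (G : SimpleGraph V) [DecidableRel G.Adj]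
    (L : Labelling G (Fintype.card V ^ a)) (ω : A.Coins G) (t : ℕ) (v : V)
    (p : Fin (G.degree v)), t < T →
      (A.send (A.run L ω t v) p).length ≤ B * Nat.clog 2 (Fintype.card V)

end DistAlgorithm

/-! The deficit Δ - codeg(u, v) satisfies the triangle inequality (`codeg_add_codeg_le`). All
thresholds are counted in units of Δ/324 = ηΔ. Each node becomes a leader with probability 1/q,
where q is a power of two of order √Δ. With high probability every neighbourhood has at most 8q
leaders and every dense node has a friend that leads. Each node votes for the neighbouring leader
whose rank is a random number below 8q. Hence each common neighbour of u and a leader l votes for l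
with probability 1/(8q), independently, and 8q times the number of votes for l among the neighbours
of u estimates codeg(u, l). A Chernoff bound makes the error at most one unit except with
probability exp(-Ω(√Δ)), which is why Δ ≥ c log² n suffices (`card_not_goodEstimates_le`).

Given good estimates, the rest is deterministic (`GoodEstimates.outputsACD`). A leader is active if
almost Δ of its neighbours are close to it. Two active leaders share at most 4 or at least 316 units
of neighbours (`codeg_of_isActive`), so active leaders form well separated clusters, and the
smallest identifier within a crude threshold Δ/2 labels a cluster consistently. Every dense node is
close to an active leader. One vote per node keeps messages short, and five rounds suffice
(`outputsACD_of_goodEstimates`). -/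

/-! ### Common neighbourhoods. -/

section Codegree

variable {V : Type} [Fintype V] [DecidableEq V] {G : SimpleGraph V} [DecidableRel G.Adj]

/-- The number of common neighbours. -/
def codeg (G : SimpleGraph V) [DecidableRel G.Adj] (u v : V) : ℕ :=
  (G.neighborFinset u ∩ G.neighborFinset v).card

lemma codeg_comm (u v : V) : codeg G u v = codeg G v u := by
  rw [codeg, inter_comm, codeg]

lemma codeg_le_maxDegree (u v : V) : codeg G u v ≤ G.maxDegree :=
  (card_le_card inter_subset_left).trans
    ((G.card_neighborFinset_eq_degree u).le.trans (G.degree_le_maxDegree u))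

/-- Inclusion–exclusion inside a neighbourhood, which has at most Δ elements. The overlap estimates
below come from this. -/
lemma card_add_card_le_of_subset_neighborFinset {v : V} {A B : Finset V}
    (hA : A ⊆ G.neighborFinset v) (hB : B ⊆ G.neighborFinset v) :
    A.card + B.card ≤ (A ∩ B).card + G.maxDegree := by
  have h1 := card_union_add_card_inter A B
  have h2 : (A ∪ B).card ≤ G.maxDegree :=
    (card_le_card (union_subset hA hB)).trans
      ((G.card_neighborFinset_eq_degree v).le.trans (G.degree_le_maxDegree v))
  omega

/-- Both common neighbourhoods lie in N(v), and their intersection lies in N(u) ∩ N(w). -/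
lemma codeg_add_codeg_le (u v w : V) :
    codeg G u v + codeg G v w ≤ codeg G u w + G.maxDegree := by
  have h := card_add_card_le_of_subset_neighborFinset (G := G) (v := v)
    (A := G.neighborFinset u ∩ G.neighborFinset v)
    (B := G.neighborFinset v ∩ G.neighborFinset w) inter_subset_right inter_subset_left
  have h2 : ((G.neighborFinset u ∩ G.neighborFinset v) ∩
      (G.neighborFinset v ∩ G.neighborFinset w)).card ≤ codeg G u w := by
    apply card_le_card
    intro x
    simp only [mem_inter]
    tauto
  unfold codeg at *
  omega

/-- A set whose members all have at least `q` neighbours in `N(v)` has at most `Δ² / q` members. -/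
lemma card_mul_le_of_le_codeg {v : V} {C : Finset V} {q : ℕ} (h : ∀ u ∈ C, q ≤ codeg G u v) :
    C.card * q ≤ G.maxDegree * G.maxDegree := by
  have h1 : C.card * q ≤ ∑ u ∈ C, codeg G u v := by
    simpa using sum_le_sum h
  have h2 : ∑ u ∈ C, codeg G u v =
      ∑ w ∈ G.neighborFinset v, (C.filter fun u => G.Adj u w).card := by
    simp_rw [card_eq_sum_ones, sum_filter]
    rw [sum_comm]
    refine sum_congr rfl fun u _ => ?_
    rw [← sum_filter, ← card_eq_sum_ones, codeg]
    congr 1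
    ext w
    simp [and_comm]
  have h3 : ∀ w ∈ G.neighborFinset v, (C.filter fun u => G.Adj u w).card ≤ G.maxDegree := by
    intro w _
    refine le_trans (card_le_card fun u hu => ?_)
      ((G.card_neighborFinset_eq_degree w).le.trans (G.degree_le_maxDegree w))
    rw [SimpleGraph.mem_neighborFinset]
    exact (mem_filter.1 hu).2.symm
  calc _ ≤ _ := h1
    _ = _ := h2
    _ ≤ ∑ w ∈ G.neighborFinset v, G.maxDegree := sum_le_sum h3
    _ ≤ _ := by
      rw [sum_const, smul_eq_mul]
      exact Nat.mul_le_mul_right _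
        ((G.card_neighborFinset_eq_degree v).le.trans (G.degree_le_maxDegree v))

/-! ### From good estimates to a decomposition. -/

/-- `u` is estimated to have almost all of `N(l)` in its neighbourhood. -/
def IsClose (G : SimpleGraph V) [DecidableRel G.Adj] (est : V → V → ℕ) (u l : V) : Prop :=
  321 * G.maxDegree ≤ 324 * est u l

instance (est : V → V → ℕ) (u l : V) : Decidable (IsClose G est u l) :=
  inferInstanceAs (Decidable (_ ≤ _))

/-- The leader `l` is close to almost `Δ` of its neighbours. -/
def IsActive (G : SimpleGraph V) [DecidableRel G.Adj] (lead : V → Prop) (est : V → V → ℕ)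
    (l : V) : Prop :=
  lead l ∧ 322 * G.maxDegree ≤ 324 * ((G.neighborFinset l).filter fun u => IsClose G est u l).card

/-- The estimates `est` of the codegrees with leaders are accurate, and every dense node has
a friend among the leaders. -/
structure GoodEstimates (G : SimpleGraph V) [DecidableRel G.Adj] (lead : V → Prop)
    (est : V → V → ℕ) : Prop where
  est_le : ∀ u l, lead l → 324 * est u l ≤ 324 * codeg G u l + G.maxDegree
  le_est : ∀ u l, lead l → 324 * codeg G u l ≤ 324 * est u l + G.maxDegree
  exists_friend : ∀ u, IsDense G (1 / 3 / 108) u → ∃ l, IsFriend G (1 / 3 / 108) u l ∧ lead l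

lemma isFriend_iff_codeg {u v : V} :
    IsFriend G (1 / 3 / 108) u v ↔ G.Adj u v ∧ 323 * G.maxDegree ≤ 324 * codeg G u v := by
  rw [IsFriend, IsSimilar, codeg]
  refine and_congr_right fun _ => ?_
  rw [← Nat.cast_le (α := ℝ)]
  push_cast
  constructor <;> intro h <;> linarith

open Classical in
lemma isDense_iff_card {u : V} :
    IsDense G (1 / 3 / 108) u ↔
      323 * G.maxDegree ≤ 324 * (univ.filter fun v => IsFriend G (1 / 3 / 108) u v).card := by
  rw [IsDense, ← Nat.cast_le (α := ℝ)]
  push_cast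
  constructor <;> intro h <;> linarith

namespace GoodEstimates

variable {lead : V → Prop} {est : V → V → ℕ} (h : GoodEstimates G lead est)
include h

lemma codeg_of_isClose {u l : V} (hl : lead l) (hu : IsClose G est u l) :
    320 * G.maxDegree ≤ 324 * codeg G u l := by
  have := h.est_le u l hl
  unfold IsClose at hu
  omega

/-- At most 2 units of the neighbours of an active leader are not close to it. So more than 4 units
of common neighbours include a node close to both leaders, and 320 + 320 - 324 = 316. -/
lemma codeg_of_isActive {l l' : V} (hl : IsActive G lead est l) (hl' : IsActive G lead est l')
    (hc : 4 * G.maxDegree < 324 * codeg G l l') : 316 * G.maxDegree ≤ 324 * codeg G l l' := by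
  set A := (G.neighborFinset l).filter fun u => IsClose G est u l
  set A' := (G.neighborFinset l').filter fun u => IsClose G est u l'
  have h1 := card_add_card_le_of_subset_neighborFinset (G := G) (v := l)
    (A := A) (B := G.neighborFinset l ∩ G.neighborFinset l') (filter_subset _ _) inter_subset_left
  have h2 := card_add_card_le_of_subset_neighborFinset (G := G) (v := l')
    (A := A') (B := A ∩ (G.neighborFinset l ∩ G.neighborFinset l')) (filter_subset _ _)
    (inter_subset_right.trans inter_subset_right)
  have ha : _ ≤ 324 * A.card := hl.2
  have ha' : _ ≤ 324 * A'.card := hl'.2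
  have hpos : 0 < (A' ∩ (A ∩ (G.neighborFinset l ∩ G.neighborFinset l'))).card := by
    unfold codeg at hc
    omega
  obtain ⟨w, hw⟩ := card_pos.1 hpos
  have hw1 := (mem_filter.1 (mem_inter.1 hw).1).2
  have hw2 := (mem_filter.1 (mem_inter.1 (mem_inter.1 hw).2).1).2
  have c1 := h.codeg_of_isClose hl'.1 hw1
  have c2 := h.codeg_of_isClose hl.1 hw2
  have c3 := codeg_add_codeg_le (G := G) l w l'
  rw [codeg_comm l w] at c3
  omega

-- Of the 323 units of friends of u, at least 323 + 323 - 324 = 322 are neighbours of the leading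
-- friend l. Each shares 322 units with l, so its estimate is at least 321.
open Classical in
lemma exists_isActive_isClose {u : V} (hu : IsDense G (1 / 3 / 108) u) :
    ∃ l, IsActive G lead est l ∧ IsClose G est u l := by
  obtain ⟨l, hf, hl⟩ := h.exists_friend u hu
  rw [isDense_iff_card] at hu
  refine ⟨l, ⟨hl, ?_⟩, ?_⟩
  · set F := univ.filter fun v => IsFriend G (1 / 3 / 108) u v
    have hul := (isFriend_iff_codeg.1 hf).2
    have hF : F ⊆ G.neighborFinset u := fun x hx =>
      (G.mem_neighborFinset _ _).2 (mem_filter.1 hx).2.1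
    have h1 := card_add_card_le_of_subset_neighborFinset (G := G) (v := u)
      (A := F) (B := G.neighborFinset u ∩ G.neighborFinset l) hF inter_subset_left
    have h2 : F ∩ (G.neighborFinset u ∩ G.neighborFinset l) ⊆
        (G.neighborFinset l).filter fun u => IsClose G est u l := by
      intro w hw
      simp only [mem_inter] at hw
      refine mem_filter.2 ⟨hw.2.2, ?_⟩
      have c1 := (isFriend_iff_codeg.1 (mem_filter.1 hw.1).2).2
      have c2 := codeg_add_codeg_le (G := G) w u l
      rw [codeg_comm w u] at c2
      have c3 := h.le_est w l hl
      unfold IsClose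
      omega
    have h3 := card_le_card h2
    unfold codeg at hul
    omega
  · have c1 := (isFriend_iff_codeg.1 hf).2
    have c3 := h.le_est u l hl
    unfold IsClose
    omega

/-- Nodes that are close to an active leader, labelled by the smallest identifier of an active
leader with which they are estimated to share half of `Δ` neighbours, form a decomposition. -/
theorem outputsACD (hΔ : 0 < G.maxDegree) {ident : V → ℕ} (hid : Function.Injective ident)
    {out : V → Option ℕ}
    (hsome : ∀ v, (∃ l, IsActive G lead est l ∧ IsClose G est v l) →
      out v = some (sInf (ident '' {l | IsActive G lead est l ∧ G.maxDegree ≤ 2 * est v l})))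
    (hnone : ∀ v, (¬ ∃ l, IsActive G lead est l ∧ IsClose G est v l) → out v = none) :
    OutputsACD G (1 / 3) (1 / 3 / 108) out := by
  have key : ∀ v i, out v = some i → ∃ l, IsActive G lead est l ∧ ident l = i ∧
      (∀ l', IsActive G lead est l' → G.maxDegree ≤ 2 * est v l' → i ≤ ident l') ∧
      312 * G.maxDegree ≤ 324 * codeg G v l := by
    intro v i hv
    by_cases hex : ∃ l, IsActive G lead est l ∧ IsClose G est v l
    swap
    · simp [hnone v hex] at hv
    have hv' := hsome v hex
    rw [hv, Option.some_inj] at hv'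
    obtain ⟨l, hl, hvl⟩ := hex
    have hne : (ident '' {l | IsActive G lead est l ∧ G.maxDegree ≤ 2 * est v l}).Nonempty := by
      refine ⟨_, l, ⟨hl, ?_⟩, rfl⟩
      unfold IsClose at hvl
      omega
    obtain ⟨l₀, ⟨hl₀, hvl₀⟩, hi⟩ := Nat.sInf_mem hne
    rw [← hv'] at hi
    refine ⟨l₀, hl₀, hi, fun l' hl' hvl' => ?_, ?_⟩
    · rw [hv']
      exact Nat.sInf_le ⟨l', ⟨hl', hvl'⟩, rfl⟩
    -- The crude threshold gives codeg(v, l₀) ≥ 161 units, hence codeg(l, l₀) ≥ 320 + 161 - 324 > 4.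
    -- The gap between 4 and 316 improves this to 316, and then codeg(v, l₀) ≥ 320 + 316 - 324 =
    -- 312.
    · have c1 := h.codeg_of_isClose hl.1 hvl
      have c2 := h.est_le v l₀ hl₀.1
      have c3 := codeg_add_codeg_le (G := G) l v l₀
      rw [codeg_comm l v] at c3
      have c4 := h.codeg_of_isActive hl hl₀ (by omega)
      have c5 := codeg_add_codeg_le (G := G) v l l₀
      omega
  -- Any candidate l' of w lies in the cluster of l. It shares 312 + 316 - 324 = 304 units with v,
  -- so it was a candidate of v too and cannot beat l.
  have close : ∀ v i l, out v = some i → IsActive G lead est l → ident l = i →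
      (∀ l', IsActive G lead est l' → G.maxDegree ≤ 2 * est v l' → i ≤ ident l') →
      312 * G.maxDegree ≤ 324 * codeg G v l →
      ∀ w, IsClose G est w l → out w = some i := by
    intro v i l hv hl hi hmin hc w hw
    have hex : ∃ l, IsActive G lead est l ∧ IsClose G est w l := ⟨l, hl, hw⟩
    rw [hsome w hex, Option.some_inj]
    have hmem : l ∈ {l | IsActive G lead est l ∧ G.maxDegree ≤ 2 * est w l} := by
      refine ⟨hl, ?_⟩
      unfold IsClose at hw
      omega
    refine le_antisymm (hi ▸ Nat.sInf_le ⟨l, hmem, rfl⟩) (le_csInf ⟨_, l, hmem, rfl⟩ ?_)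
    rintro _ ⟨l', ⟨hl', hwl'⟩, rfl⟩
    refine hmin l' hl' ?_
    have c1 := h.codeg_of_isClose hl.1 hw
    have c2 := h.est_le w l' hl'.1
    have c3 := codeg_add_codeg_le (G := G) l w l'
    rw [codeg_comm l w] at c3
    have c4 := h.codeg_of_isActive hl hl' (by omega)
    have c5 := codeg_add_codeg_le (G := G) v l l'
    have c6 := h.le_est v l' hl'.1
    omega
  classical
  set S : Finset ℕ := univ.biUnion fun v => (out v).toFinset
  have hS : ∀ i, i ∈ S ↔ ∃ v, out v = some i := by
    intro i
    simp [S]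
  -- The common neighbours of v and its leader l that are close to l have the same label: 312 + 322
  -- - 324 = 310 units.
  have hnbr : ∀ v i, out v = some i →
      310 * G.maxDegree ≤
        324 * (G.neighborFinset v ∩ univ.filter fun w => out w = some i).card := by
    intro v i hv
    obtain ⟨l, hl, hi, hmin, hc⟩ := key v i hv
    have h1 := card_add_card_le_of_subset_neighborFinset (G := G) (v := l)
      (A := (G.neighborFinset l).filter fun u => IsClose G est u l)
      (B := G.neighborFinset v ∩ G.neighborFinset l) (filter_subset _ _) inter_subset_right
    have h2 : ((G.neighborFinset l).filter fun u => IsClose G est u l) ∩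
        (G.neighborFinset v ∩ G.neighborFinset l) ⊆
        G.neighborFinset v ∩ univ.filter fun w => out w = some i := by
      intro w hw
      simp only [mem_inter] at hw
      exact mem_inter.2 ⟨hw.2.1, mem_filter.2 ⟨mem_univ _,
        close v i l hv hl hi hmin hc w (mem_filter.1 hw.1).2⟩⟩
    have h3 := card_le_card h2
    have h4 := hl.2
    unfold codeg at hc
    omega
  have hΔ' : (0 : ℝ) < G.maxDegree := by exact_mod_cast hΔ
  refine ⟨univ.filter fun v => out v = none, S.card,
    fun i => univ.filter fun v => out v = some (S.equivFin.symm i : ℕ),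
    fun i => S.equivFin.symm i, ⟨?_, ?_, ?_, ?_, ?_, ?_, ?_⟩, ?_, ?_, ?_⟩
  · intro v
    rcases hv : out v with _ | i
    · simp [hv]
    · right
      refine ⟨S.equivFin ⟨i, (hS i).2 ⟨v, hv⟩⟩, ?_⟩
      simp [hv]
  · intro i
    rw [disjoint_filter]
    intro v _ hv
    simp [hv]
  · intro i j hij
    rw [disjoint_filter]
    intro v _ hv hv'
    rw [hv, Option.some_inj] at hv'
    exact hij (S.equivFin.symm.injective (Subtype.ext hv'))
  · intro v hv hd
    have := hsome v (h.exists_isActive_isClose hd)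
    rw [(mem_filter.1 hv).2] at this
    cases this
  · intro i
    obtain ⟨v, hv⟩ := (hS _).1 (S.equivFin.symm i).2
    have h1 := hnbr v _ hv
    have h2 := card_le_card (inter_subset_right (s₁ := G.neighborFinset v)
      (s₂ := univ.filter fun w => out w = some (S.equivFin.symm i : ℕ)))
    have h3 : 310 * G.maxDegree ≤
        324 * (univ.filter fun w => out w = some (S.equivFin.symm i : ℕ)).card := by omega
    have h4 : (310 : ℝ) * G.maxDegree ≤
        324 * (univ.filter fun w => out w = some (S.equivFin.symm i : ℕ)).card := by
      exact_mod_cast h3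
    linarith
  · intro i
    obtain ⟨v, hv⟩ := (hS _).1 (S.equivFin.symm i).2
    obtain ⟨l, hl, hi, hmin, hc⟩ := key v _ hv
    -- The bound is 312 units rounded up. All members have the same leader, as identifiers are
    -- distinct, so double counting gives |C| ≤ (324/312)Δ.
    have hall : ∀ u ∈ univ.filter fun w => out w = some (S.equivFin.symm i : ℕ),
        (312 * G.maxDegree + 323) / 324 ≤ codeg G u l := by
      intro u hu
      obtain ⟨l', hl', hi', -, hc'⟩ := key u _ (mem_filter.1 hu).2
      have : l' = l := hid (hi'.trans hi.symm)
      subst this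
      omega
    have h1 := card_mul_le_of_le_codeg hall
    have h2 : 312 * G.maxDegree ≤ 324 * ((312 * G.maxDegree + 323) / 324) := by omega
    have h3 := Nat.mul_le_mul_left
      (univ.filter fun w => out w = some (S.equivFin.symm i : ℕ)).card h2
    have h4 : (univ.filter fun w => out w = some (S.equivFin.symm i : ℕ)).card * 312 ≤
        324 * G.maxDegree := by
      refine Nat.le_of_mul_le_mul_right ?_ hΔ
      nlinarith
    have h5 : ((univ.filter fun w => out w = some (S.equivFin.symm i : ℕ)).card : ℝ) * 312 ≤
        324 * G.maxDegree := by exact_mod_cast h4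
    linarith
  · intro i v hv
    have h1 := hnbr v _ (mem_filter.1 hv).2
    have h4 : (310 : ℝ) * G.maxDegree ≤ 324 * (G.neighborFinset v ∩
        univ.filter fun w => out w = some (S.equivFin.symm i : ℕ)).card := by
      exact_mod_cast h1
    linarith
  · exact Subtype.val_injective.comp S.equivFin.symm.injective
  · intro v hv
    exact (mem_filter.1 hv).2
  · intro i v hv
    exact (mem_filter.1 hv).2

end GoodEstimates

end Codegree

/-! ### Ports, and votes by rank among the leaders. -/

section Ports

variable {V : Type} [Fintype V] [DecidableEq V] {G : SimpleGraph V} [DecidableRel G.Adj]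
  {idBound : ℕ} (L : Labelling G idBound)

namespace Labelling

/-- The port of `v` that leads to its neighbour `u`. -/
def portTo (v u : V) : ℕ :=
  if h : G.Adj v u then L.port v ⟨u, h⟩ else 0

variable {L}

lemma portTo_lt {v u : V} (h : G.Adj v u) : L.portTo v u < G.degree v := by
  rw [portTo, dif_pos h]
  exact Fin.is_lt _

lemma portTo_inj {v u u' : V} (h : G.Adj v u) (h' : G.Adj v u')
    (he : L.portTo v u = L.portTo v u') : u = u' := by
  rw [portTo, portTo, dif_pos h, dif_pos h', Fin.val_inj] at he
  exact congrArg Subtype.val ((L.port v).injective he)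

variable (L) in
lemma exists_portTo_eq {v : V} {p : ℕ} (hp : p < G.degree v) :
    ∃ u, G.Adj v u ∧ L.portTo v u = p := by
  obtain ⟨u, hu⟩ := (L.port v).surjective ⟨p, hp⟩
  have h : G.Adj v u.1 := u.2
  refine ⟨u.1, h, ?_⟩
  rw [portTo, dif_pos h]
  exact congrArg Fin.val hu

variable (A : DistAlgorithm)

lemma inbox_portTo (s : V → A.State) {v u : V} (h : G.Adj v u) :
    A.inbox L s v (L.portTo v u) = A.send (s u) (L.portTo u v) := by
  have hp : (L.port v).symm ⟨L.portTo v u, portTo_lt h⟩ = ⟨u, h⟩ := by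
    rw [Equiv.symm_apply_eq]
    ext
    simp [portTo, h]
  -- The adjacency proof depends on the neighbour found at the port, so that neighbour is
  -- generalized before the substitution.
  have key : ∀ x : G.neighborSet v, x = ⟨u, h⟩ →
      A.send (s x.1) (L.port x.1 ⟨v, G.adj_symm x.2⟩) = A.send (s u) (L.portTo u v) := by
    rintro _ rfl
    rw [portTo, dif_pos h.symm]
  rw [DistAlgorithm.inbox, dif_pos (portTo_lt h)]
  exact key _ hp

lemma inbox_eq_nil (s : V → A.State) {v : V} {p : ℕ} (h : ¬ p < G.degree v) :
    A.inbox L s v p = [] := dif_neg h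

lemma card_filter_range_degree (v : V) (P : ℕ → Prop) (R : V → Prop) [DecidablePred P]
    [DecidablePred R] (h : ∀ u, G.Adj v u → (P (L.portTo v u) ↔ R u)) :
    ((range (G.degree v)).filter P).card = ((G.neighborFinset v).filter R).card := by
  symm
  refine card_bij (fun u _ => L.portTo v u) ?_ ?_ ?_
  · intro u hu
    rw [mem_filter, SimpleGraph.mem_neighborFinset] at hu
    exact mem_filter.2 ⟨mem_range.2 (portTo_lt hu.1), (h u hu.1).2 hu.2⟩
  · intro u hu u' hu' he
    rw [mem_filter, SimpleGraph.mem_neighborFinset] at hu hu'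
    exact portTo_inj hu.1 hu'.1 he
  · intro p hp
    rw [mem_filter, mem_range] at hp
    obtain ⟨u, hu, rfl⟩ := L.exists_portTo_eq hp.1
    exact ⟨u, mem_filter.2 ⟨(G.mem_neighborFinset _ _).2 hu, (h u hu).1 hp.2⟩, rfl⟩

variable (L)

/-- The number of leaders at the ports of `w` before the port to `l`. -/
def leaderRank (lead : V → Bool) (w l : V) : ℕ :=
  ((G.neighborFinset w).filter fun u => lead u = true ∧ L.portTo w u < L.portTo w l).card

/-- `w` votes for its neighbouring leader `l` of rank `idx w`. -/
def Votes (lead : V → Bool) (idx : V → ℕ) (w l : V) : Prop :=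
  G.Adj w l ∧ lead l = true ∧ L.leaderRank lead w l = idx w

instance (lead : V → Bool) (idx : V → ℕ) (w l : V) : Decidable (L.Votes lead idx w l) :=
  inferInstanceAs (Decidable (_ ∧ _))

/-- The number of neighbours of `u` that vote for `l`. -/
def voteCount (lead : V → Bool) (idx : V → ℕ) (u l : V) : ℕ :=
  ((G.neighborFinset u).filter fun w => L.Votes lead idx w l).card

end Labelling

end Ports

/-! ### The algorithm. -/

/-- The state of a node: its initial knowledge, its random choices, and the history of the
messages it has received, by round and port. -/
structure VoteState where
  cap : ℕ
  maxDeg : ℕ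
  ident : ℕ
  degree : ℕ
  lead : Bool
  idx : ℕ
  round : ℕ
  inb : ℕ → ℕ → List Bool

/-- The number of bits that decide whether a node is a leader. -/
def leadBits (Δ : ℕ) : ℕ := Nat.log 4 Δ

/-- The number of values of the random index that determines the vote of a node. -/
def numIdx (Δ : ℕ) : ℕ := 2 ^ (leadBits Δ + 3)

/-- A nonempty binary encoding of a number. -/
def encodeBits (i : ℕ) : List Bool := true :: i.bits

lemma encodeBits_ne_nil (i : ℕ) : encodeBits i ≠ [] := List.cons_ne_nil _ _

lemma encodeBits_injective : Function.Injective encodeBits := by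
  intro i j h
  have h' : i.bits = j.bits := (List.cons.inj h).2
  refine Nat.eq_of_testBit_eq fun k => ?_
  rw [Nat.testBit_eq_inth, Nat.testBit_eq_inth, h']

/-- The number itself takes at most a⌈log₂ n⌉ bits; as n ≥ 2, one more ⌈log₂ n⌉ pays for the leading
bit. -/
lemma length_encodeBits_le {n a i : ℕ} (hn : 2 ≤ n) (hi : i < n ^ a) :
    (encodeBits i).length ≤ (a + 1) * Nat.clog 2 n := by
  have h1 : i < 2 ^ (Nat.clog 2 n * a) := by
    rw [pow_mul]
    exact hi.trans_le (Nat.pow_le_pow_left (Nat.le_pow_clog one_lt_two n) a)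
  have h2 := Nat.size_le.2 h1
  have h3 := Nat.clog_pos one_lt_two hn
  rw [encodeBits, List.length_cons, Nat.size_eq_bits_len]
  linarith

namespace VoteState

variable (s : VoteState)

/-- How often the message `m` arrived in round `i`. -/
def tally (i : ℕ) (m : List Bool) : ℕ :=
  ((range s.degree).filter fun p => s.inb i p = m).card

/-- The port of the leader with rank `idx`, if there is one. -/
noncomputable def votePort : ℕ := Nat.nth (fun p => s.inb 0 p ≠ []) s.idx

/-- The encoded identifier of the leader for which the node votes. -/
noncomputable def vote : List Bool :=
  -- If no leader has rank `idx`, then `Nat.nth` defaults to port 0, where the count is 0. The test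
  -- then passes only for `idx = 0`, when there is no neighbouring leader and port 0 is silent.
  if Nat.count (fun p => s.inb 0 p ≠ []) s.votePort = s.idx then s.inb 0 s.votePort else []

/-- The message through the port `p` in round `i`. Leaders send their identifiers; all nodes vote
for a leader; they tell a leader whether its votes indicate many common neighbours; leaders
announce whether enough neighbours have told them so; votes for such leaders are repeated. -/
noncomputable def msg (p : ℕ) : ℕ → List Bool
  | 0 => if s.lead = true then encodeBits s.ident else []
  | 1 => s.vote
  | 2 =>
    if s.inb 0 p ≠ [] ∧ 321 * s.maxDeg ≤ 324 * (numIdx s.maxDeg * s.tally 1 (s.inb 0 p)) then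
      [true] else []
  | 3 =>
    if s.lead = true ∧
        322 * s.maxDeg ≤ 324 * ((range s.degree).filter fun p => s.inb 2 p ≠ []).card then
      [true] else []
  | 4 => if s.inb 3 s.votePort ≠ [] then s.vote else []
  | _ => []

open Classical in
/-- The smallest identifier of an active leader with at least half of the votes that a clone
of the node would receive, if some leader has almost as many votes as such a clone. -/
noncomputable def result : Option ℕ :=
  if ∃ i, 321 * s.maxDeg ≤ 324 * (numIdx s.maxDeg * s.tally 4 (encodeBits i)) then
    some (sInf {i | s.maxDeg ≤ 2 * (numIdx s.maxDeg * s.tally 4 (encodeBits i))})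
  else none

end VoteState

lemma card_bits_eq (k : ℕ) :
    Fintype.card (Fin (2 * k + 3) → Bool) = Fintype.card (Fin (2 ^ k) × Fin (2 ^ (k + 3))) := by
  simp only [Fintype.card_pi, Fintype.card_bool, Fintype.card_prod, Fintype.card_fin,
    prod_const, card_univ]
  ring

/-- Random bits as a pair of random numbers. -/
noncomputable def bitsEquiv (k : ℕ) :
    (Fin (2 * k + 3) → Bool) ≃ Fin (2 ^ k) × Fin (2 ^ (k + 3)) :=
  Fintype.equivOfCardEq (card_bits_eq k)

/-- The voting algorithm, for identifiers below `n ^ a`. -/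
noncomputable def voteAlgorithm (a : ℕ) : DistAlgorithm where
  State := VoteState
  numBits _ Δ := 2 * leadBits Δ + 3
  init n Δ ident degree ω :=
    { cap := (a + 1) * Nat.clog 2 n
      maxDeg := Δ
      ident := ident
      degree := degree
      lead := decide ((bitsEquiv _ ω).1.val = 0)
      idx := (bitsEquiv _ ω).2.val
      round := 0
      inb := fun _ _ => [] }
  -- Truncation makes the CONGEST bound immediate. With identifiers below n ^ a it never shortens a
  -- message sent along an edge.
  send s p := (s.msg p s.round).take s.cap
  receive s m := { s with
    round := s.round + 1
    inb := Function.update s.inb s.round m }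
  output s := s.result

/-! ### Executions in closed form. -/

section Run

variable (a : ℕ) {V : Type} [Fintype V] [DecidableEq V] {G : SimpleGraph V} [DecidableRel G.Adj]

/-- The nodes that become leaders. -/
noncomputable def leaders (ω : (voteAlgorithm a).Coins G) (v : V) : Bool :=
  decide ((bitsEquiv _ (ω v)).1.val = 0)

/-- The indices that determine the votes. -/
noncomputable def voteIdx (ω : (voteAlgorithm a).Coins G) (v : V) : ℕ := (bitsEquiv _ (ω v)).2.val

variable {idBound : ℕ} (L : Labelling G idBound) (ω : (voteAlgorithm a).Coins G)

/-- A round writes only its own entry of the history, so the messages of round i can be read off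
from any later state. -/
lemma run_voteAlgorithm (t : ℕ) (v : V) :
    (voteAlgorithm a).run L ω t v =
      ({ cap := (a + 1) * Nat.clog 2 (Fintype.card V)
         maxDeg := G.maxDegree
         ident := L.ident v
         degree := G.degree v
         lead := leaders a ω v
         idx := voteIdx a ω v
         round := t
         inb := fun i => if i < t then
           (voteAlgorithm a).inbox L ((voteAlgorithm a).run L ω i) v else fun _ => [] } :
        VoteState) := by
  induction t with
  | zero => rfl
  | succ t ih =>
    refine (congrArg (fun s => (voteAlgorithm a).receive s
      ((voteAlgorithm a).inbox L ((voteAlgorithm a).run L ω t) v)) ih).trans ?_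
    refine congrArg (VoteState.mk ((a + 1) * Nat.clog 2 (Fintype.card V)) G.maxDegree (L.ident v)
      (G.degree v) (leaders a ω v) (voteIdx a ω v) (t + 1)) ?_
    funext i
    dsimp only
    by_cases hi : i = t
    · subst hi
      simp
    · rw [Function.update_of_ne hi]
      have : i < t + 1 ↔ i < t := by omega
      simp only [this]

lemma isCongest_voteAlgorithm (T : ℕ) : (voteAlgorithm a).IsCongest T a (a + 1) := by
  intro V _ _ G _ L ω t v p _
  rw [run_voteAlgorithm]
  exact List.length_take_le _ _

end Run

/-! ### The meaning of the messages in each round. -/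

section Messages

variable {a : ℕ} {V : Type} [Fintype V] [DecidableEq V] {G : SimpleGraph V} [DecidableRel G.Adj]
  {L : Labelling G (Fintype.card V ^ a)} {ω : (voteAlgorithm a).Coins G}

variable (L ω) in
/-- The state of the node `v` after `t` rounds. -/
noncomputable def stateAt (t : ℕ) (v : V) : VoteState := (voteAlgorithm a).run L ω t v

variable (L ω) in
/-- The message that the node `u` sends through the port `p` in round `i`. -/
noncomputable def sent (i : ℕ) (u : V) (p : ℕ) : List Bool :=
  ((stateAt L ω i u).msg p i).take ((a + 1) * Nat.clog 2 (Fintype.card V))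

lemma send_eq_sent (i : ℕ) (u : V) (p : ℕ) :
    (voteAlgorithm a).send ((voteAlgorithm a).run L ω i u) p = sent L ω i u p := by
  rw [sent, stateAt, run_voteAlgorithm]
  rfl

lemma inb_portTo {t i : ℕ} (hi : i < t) {v u : V} (h : G.Adj v u) :
    (stateAt L ω t v).inb i (L.portTo v u) = sent L ω i u (L.portTo u v) := by
  rw [stateAt, run_voteAlgorithm]
  simp only [hi, if_true]
  rw [Labelling.inbox_portTo _ _ h, send_eq_sent]

lemma inb_eq_nil {t i : ℕ} {v : V} {p : ℕ} (h : ¬ p < G.degree v) :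
    (stateAt L ω t v).inb i p = [] := by
  rw [stateAt, run_voteAlgorithm]
  dsimp only
  split_ifs
  · exact Labelling.inbox_eq_nil _ _ h
  · rfl

lemma stateAt_lead (t : ℕ) (v : V) : (stateAt L ω t v).lead = leaders a ω v := by
  rw [stateAt, run_voteAlgorithm]

lemma stateAt_idx (t : ℕ) (v : V) : (stateAt L ω t v).idx = voteIdx a ω v := by
  rw [stateAt, run_voteAlgorithm]

lemma stateAt_ident (t : ℕ) (v : V) : (stateAt L ω t v).ident = L.ident v := by
  rw [stateAt, run_voteAlgorithm]

lemma stateAt_degree (t : ℕ) (v : V) : (stateAt L ω t v).degree = G.degree v := by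
  rw [stateAt, run_voteAlgorithm]

lemma stateAt_maxDeg (t : ℕ) (v : V) : (stateAt L ω t v).maxDeg = G.maxDegree := by
  rw [stateAt, run_voteAlgorithm]

lemma tally_eq {t i : ℕ} (hi : i < t) (v : V) (m : List Bool) (R : V → Prop) [DecidablePred R]
    (h : ∀ u, G.Adj v u → (sent L ω i u (L.portTo u v) = m ↔ R u)) :
    (stateAt L ω t v).tally i m = ((G.neighborFinset v).filter R).card := by
  rw [VoteState.tally, stateAt_degree]
  refine Labelling.card_filter_range_degree (L := L) v _ R fun u hu => ?_
  rw [inb_portTo hi hu]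
  exact h u hu

omit [DecidableEq V] [DecidableRel G.Adj] in
lemma two_le_card_of_adj {u v : V} (h : G.Adj u v) : 2 ≤ Fintype.card V :=
  Fintype.one_lt_card_iff.2 ⟨u, v, h.ne⟩

lemma take_encodeBits {u v : V} (h : G.Adj u v) (w : V) :
    (encodeBits (L.ident w)).take ((a + 1) * Nat.clog 2 (Fintype.card V)) =
      encodeBits (L.ident w) :=
  List.take_of_length_le (length_encodeBits_le (two_le_card_of_adj h) (L.ident_lt w))

omit [DecidableEq V] [DecidableRel G.Adj] in
lemma take_singleton {u v : V} (h : G.Adj u v) :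
    [true].take ((a + 1) * Nat.clog 2 (Fintype.card V)) = [true] := by
  refine List.take_of_length_le ?_
  exact Nat.mul_pos a.succ_pos (Nat.clog_pos one_lt_two (two_le_card_of_adj h))

lemma sent_zero {v u : V} (h : G.Adj u v) (p : ℕ) :
    sent L ω 0 u p = if leaders a ω u = true then encodeBits (L.ident u) else [] := by
  rw [sent, VoteState.msg, stateAt_lead, stateAt_ident]
  split_ifs
  · exact take_encodeBits h u
  · exact List.take_nil

lemma inb_zero {t : ℕ} (ht : 0 < t) {v u : V} (h : G.Adj v u) :
    (stateAt L ω t v).inb 0 (L.portTo v u) =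
      if leaders a ω u = true then encodeBits (L.ident u) else [] := by
  rw [inb_portTo ht h, sent_zero h.symm]

lemma inb_zero_ne_nil {t : ℕ} (ht : 0 < t) {v u : V} (h : G.Adj v u) :
    (stateAt L ω t v).inb 0 (L.portTo v u) ≠ [] ↔ leaders a ω u = true := by
  rw [inb_zero ht h]
  split_ifs with hu
  · simp [hu, encodeBits_ne_nil]
  · simp [hu]

lemma exists_of_inb_ne_nil {t i p : ℕ} {v : V} (hp : (stateAt L ω t v).inb i p ≠ []) :
    ∃ u, G.Adj v u ∧ L.portTo v u = p := by
  by_contra hne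
  exact hp (inb_eq_nil fun hlt => hne (L.exists_portTo_eq hlt))

lemma count_eq_leaderRank {t : ℕ} (ht : 0 < t) {v l : V} (h : G.Adj v l) :
    Nat.count (fun p => (stateAt L ω t v).inb 0 p ≠ []) (L.portTo v l) =
      L.leaderRank (leaders a ω) v l := by
  rw [Nat.count_eq_card_filter_range, Labelling.leaderRank,
    ← Labelling.card_filter_range_degree (L := L) v
      (fun p => (stateAt L ω t v).inb 0 p ≠ [] ∧ p < L.portTo v l)]
  · congr 1
    ext p
    simp only [mem_filter, mem_range]
    have := Labelling.portTo_lt (L := L) h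
    constructor
    · rintro ⟨h1, h2⟩
      exact ⟨by omega, h2, h1⟩
    · rintro ⟨-, h2, h1⟩
      exact ⟨h1, h2⟩
  · intro u hu
    rw [inb_zero_ne_nil ht hu]

/-- `Nat.nth` inverts `Nat.count` on the ports of leaders, and the count at the port to a leader is
its rank. -/
lemma vote_cases {t : ℕ} (ht : 0 < t) (w : V) :
    (∃ l, L.Votes (leaders a ω) (voteIdx a ω) w l ∧
      (stateAt L ω t w).votePort = L.portTo w l ∧
      (stateAt L ω t w).vote = encodeBits (L.ident l)) ∨
    ((∀ l, ¬ L.Votes (leaders a ω) (voteIdx a ω) w l) ∧ (stateAt L ω t w).vote = []) := by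
  by_cases hex : ∃ l, L.Votes (leaders a ω) (voteIdx a ω) w l
  · obtain ⟨l, hl⟩ := hex
    left
    have hc := count_eq_leaderRank (L := L) (ω := ω) ht hl.1
    have hp : (stateAt L ω t w).votePort = L.portTo w l := by
      rw [VoteState.votePort, stateAt_idx, ← hl.2.2, ← hc]
      exact Nat.nth_count (p := fun p => (stateAt L ω t w).inb 0 p ≠ [])
        ((inb_zero_ne_nil ht hl.1).2 hl.2.1)
    refine ⟨l, hl, hp, ?_⟩
    rw [VoteState.vote, hp, stateAt_idx, hc, if_pos hl.2.2, inb_zero ht hl.1, if_pos hl.2.1]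
  · right
    push Not at hex
    refine ⟨hex, ?_⟩
    by_contra hne
    rw [VoteState.vote] at hne
    split_ifs at hne with hc
    swap
    · exact hne rfl
    obtain ⟨l, hl, hp⟩ := exists_of_inb_ne_nil hne
    rw [← hp] at hc hne
    rw [count_eq_leaderRank ht hl, stateAt_idx] at hc
    exact hex l ⟨hl, (inb_zero_ne_nil ht hl).1 hne, hc⟩

/-- Among leaders, the rank is strictly increasing in the port. -/
lemma votes_unique {lead : V → Bool} {idx : V → ℕ} {w l l' : V} (h : L.Votes lead idx w l)
    (h' : L.Votes lead idx w l') : l = l' := by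
  have hlt : ∀ {l l' : V}, L.Votes lead idx w l → L.Votes lead idx w l' →
      ¬ L.portTo w l < L.portTo w l' := by
    intro l l' h h' hlt
    have hlt' : L.leaderRank lead w l < L.leaderRank lead w l' := by
      apply card_lt_card
      refine (Finset.ssubset_iff_of_subset ?_).2 ⟨l, ?_, ?_⟩
      · intro u hu
        rw [mem_filter] at hu ⊢
        exact ⟨hu.1, hu.2.1, hu.2.2.trans hlt⟩
      · exact mem_filter.2 ⟨(G.mem_neighborFinset _ _).2 h.1, h.2.1, hlt⟩
      · simp
    exact hlt'.ne (h.2.2.trans h'.2.2.symm)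
  exact Labelling.portTo_inj h.1 h'.1 (le_antisymm (not_lt.1 (hlt h' h)) (not_lt.1 (hlt h h')))

lemma sent_one_eq_iff {w v : V} (h : G.Adj w v) (p l) :
    sent L ω 1 w p = encodeBits (L.ident l) ↔ L.Votes (leaders a ω) (voteIdx a ω) w l := by
  rw [sent, VoteState.msg]
  rcases vote_cases (L := L) (ω := ω) one_pos w with ⟨l', hl', -, he⟩ | ⟨hn, he⟩
  · rw [he, take_encodeBits h]
    constructor
    · intro heq
      rwa [← L.ident_injective (encodeBits_injective heq)]
    · intro hl
      rw [votes_unique hl hl']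
  · rw [he, List.take_nil]
    exact ⟨fun heq => absurd heq.symm (encodeBits_ne_nil _), fun hl => absurd hl (hn l)⟩

variable (L ω) in
/-- The estimate of the number of common neighbours of `u` and a leader `l`. -/
noncomputable def voteEst (u l : V) : ℕ :=
  numIdx G.maxDegree * L.voteCount (leaders a ω) (voteIdx a ω) u l

lemma tally_one {t : ℕ} (ht : 1 < t) (u l : V) :
    (stateAt L ω t u).tally 1 (encodeBits (L.ident l)) =
      L.voteCount (leaders a ω) (voteIdx a ω) u l :=
  tally_eq ht u _ _ fun _ hw => sent_one_eq_iff hw.symm _ l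

lemma sent_two_ne_nil {u v : V} (h : G.Adj u v) :
    sent L ω 2 u (L.portTo u v) ≠ [] ↔
      leaders a ω v = true ∧ IsClose G (voteEst L ω) u v := by
  rw [sent, VoteState.msg, inb_zero two_pos h]
  by_cases hv : leaders a ω v = true
  · rw [if_pos hv, tally_one one_lt_two, stateAt_maxDeg]
    by_cases hc : IsClose G (voteEst L ω) u v
    · rw [if_pos ⟨encodeBits_ne_nil _, hc⟩, take_singleton h]
      simp [hv, hc]
    · rw [if_neg fun hn => hc hn.2]
      simp [hc]
  · simp [hv]

lemma sent_three_ne_nil {u v : V} (h : G.Adj u v) (p : ℕ) :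
    sent L ω 3 u p ≠ [] ↔ IsActive G (fun v => leaders a ω v = true) (voteEst L ω) u := by
  rw [sent, VoteState.msg, stateAt_lead, stateAt_maxDeg, stateAt_degree]
  by_cases hu : leaders a ω u = true
  · rw [Labelling.card_filter_range_degree (L := L) u _ (fun w => IsClose G (voteEst L ω) w u)]
    · unfold IsActive
      split_ifs with hc
      · rw [take_singleton h]
        simp [hc]
      · simp [hc]
    · intro w hw
      rw [inb_portTo (by norm_num) hw, sent_two_ne_nil hw.symm]
      simp [hu]
  · rw [if_neg fun hn => hu hn.1]
    simp [IsActive, hu]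

lemma sent_four_eq_iff {w v : V} (h : G.Adj w v) (p i) :
    sent L ω 4 w p = encodeBits i ↔ ∃ l, L.Votes (leaders a ω) (voteIdx a ω) w l ∧
      IsActive G (fun v => leaders a ω v = true) (voteEst L ω) l ∧ L.ident l = i := by
  rw [sent, VoteState.msg]
  rcases vote_cases (L := L) (ω := ω) four_pos w with ⟨l, hl, hp, he⟩ | ⟨hn, he⟩
  · rw [he, hp, inb_portTo (by norm_num) hl.1]
    by_cases hc : IsActive G (fun v => leaders a ω v = true) (voteEst L ω) l
    · rw [if_pos ((sent_three_ne_nil hl.1.symm _).2 hc), take_encodeBits h]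
      constructor
      · intro heq
        exact ⟨l, hl, hc, encodeBits_injective heq⟩
      · rintro ⟨l', hl', -, rfl⟩
        rw [votes_unique hl hl']
    · rw [if_neg fun hn => hc ((sent_three_ne_nil hl.1.symm _).1 hn), List.take_nil]
      refine ⟨fun heq => absurd heq.symm (encodeBits_ne_nil _), ?_⟩
      rintro ⟨l', hl', hc', -⟩
      rw [votes_unique hl hl'] at hc
      exact absurd hc' hc
  · rw [he, ite_self, List.take_nil]
    refine ⟨fun heq => absurd heq.symm (encodeBits_ne_nil _), ?_⟩
    rintro ⟨l', hl', -⟩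
    exact absurd hl' (hn l')

/-- Nodes not adjacent to l learn only from the repeated votes that l is active; no vote for an
active leader is lost in the repetition. -/
lemma tally_four_of_isActive (v : V) {l : V}
    (hl : IsActive G (fun v => leaders a ω v = true) (voteEst L ω) l) :
    (stateAt L ω 5 v).tally 4 (encodeBits (L.ident l)) =
      L.voteCount (leaders a ω) (voteIdx a ω) v l := by
  refine tally_eq (by norm_num) v _ _ fun w hw => ?_
  rw [sent_four_eq_iff hw.symm]
  constructor
  · rintro ⟨l', hl', -, he⟩
    rwa [← L.ident_injective he]
  · intro h
    exact ⟨l, h, hl, rfl⟩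

lemma exists_isActive_of_tally_four {v : V} {i : ℕ}
    (h : 0 < (stateAt L ω 5 v).tally 4 (encodeBits i)) :
    ∃ l, IsActive G (fun v => leaders a ω v = true) (voteEst L ω) l ∧ L.ident l = i := by
  obtain ⟨p, hp⟩ := card_pos.1 h
  rw [mem_filter, mem_range, stateAt_degree] at hp
  obtain ⟨u, hu, rfl⟩ := L.exists_portTo_eq hp.1
  have h2 := hp.2
  rw [inb_portTo (by norm_num) hu, sent_four_eq_iff hu.symm] at h2
  obtain ⟨l, -, hl, he⟩ := h2
  exact ⟨l, hl, he⟩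

/-- If the votes give good estimates, then the algorithm computes a decomposition. -/
theorem outputsACD_of_goodEstimates (hΔ : 0 < G.maxDegree)
    (h : GoodEstimates G (fun v => leaders a ω v = true) (voteEst L ω)) :
    OutputsACD G (1 / 3) (1 / 3 / 108)
      fun v => (voteAlgorithm a).output ((voteAlgorithm a).run L ω 5 v) := by
  have hout : ∀ v, (voteAlgorithm a).output ((voteAlgorithm a).run L ω 5 v) =
      (stateAt L ω 5 v).result := fun _ => rfl
  have hex : ∀ v, (∃ i, 321 * G.maxDegree ≤
      324 * (numIdx G.maxDegree * (stateAt L ω 5 v).tally 4 (encodeBits i))) ↔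
      ∃ l, IsActive G (fun v => leaders a ω v = true) (voteEst L ω) l ∧
        IsClose G (voteEst L ω) v l := by
    intro v
    constructor
    -- As Δ > 0, reaching the threshold forces a positive tally, so i belongs to an active leader.
    · rintro ⟨i, hi⟩
      obtain ⟨l, hl, rfl⟩ := exists_isActive_of_tally_four (L := L) (ω := ω) (v := v) (i := i) (by
        by_contra hz
        have hz' : (stateAt L ω 5 v).tally 4 (encodeBits i) = 0 := by omega
        rw [hz'] at hi
        omega)
      rw [tally_four_of_isActive v hl] at hi
      exact ⟨l, hl, hi⟩
    · rintro ⟨l, hl, hc⟩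
      refine ⟨L.ident l, ?_⟩
      rw [tally_four_of_isActive v hl]
      exact hc
  refine h.outputsACD hΔ L.ident_injective (fun v hv => ?_) (fun v hv => ?_)
  · rw [hout, VoteState.result, stateAt_maxDeg, if_pos ((hex v).2 hv)]
    congr 2
    ext i
    simp only [Set.mem_ofPred_eq, Set.mem_image]
    constructor
    · intro hi
      obtain ⟨l, hl, rfl⟩ := exists_isActive_of_tally_four (L := L) (ω := ω) (v := v) (i := i) (by
        by_contra hz
        have hz' : (stateAt L ω 5 v).tally 4 (encodeBits i) = 0 := by omega
        rw [hz'] at hi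
        omega)
      rw [tally_four_of_isActive v hl] at hi
      exact ⟨l, ⟨hl, hi⟩, rfl⟩
    · rintro ⟨l, ⟨hl, hi⟩, rfl⟩
      rw [tally_four_of_isActive v hl]
      exact hi
  · rw [hout, VoteState.result, stateAt_maxDeg, if_neg fun hn => hv ((hex v).1 hn)]

end Messages

/-! ### Union, conditioning and Chernoff bounds by counting. -/

section Counting

lemma card_filter_le_of_forall_exists {Ω ι : Type*} [Fintype Ω] [Fintype ι] (P : Ω → Prop)
    (E : ι → Ω → Prop) [DecidablePred P] [∀ i, DecidablePred (E i)] (c : ℝ)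
    (hc : ∀ i, ((univ.filter (E i)).card : ℝ) ≤ c) (h : ∀ x, P x → ∃ i, E i x) :
    ((univ.filter P).card : ℝ) ≤ Fintype.card ι * c := by
  classical
  have h1 : univ.filter P ⊆ univ.biUnion fun i => univ.filter (E i) := by
    intro x hx
    obtain ⟨i, hi⟩ := h x (mem_filter.1 hx).2
    exact mem_biUnion.2 ⟨i, mem_univ _, mem_filter.2 ⟨mem_univ _, hi⟩⟩
  calc ((univ.filter P).card : ℝ) ≤ ∑ i, ((univ.filter (E i)).card : ℝ) := by
        exact_mod_cast (card_le_card h1).trans card_biUnion_le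
    _ ≤ ∑ _i : ι, c := sum_le_sum fun i _ => hc i
    _ = _ := by simp

lemma card_filter_le_of_imp {Ω : Type*} [Fintype Ω] {P Q : Ω → Prop} [DecidablePred P]
    [DecidablePred Q] {c : ℝ} (hQ : ((univ.filter Q).card : ℝ) ≤ c) (h : ∀ x, P x → Q x) :
    ((univ.filter P).card : ℝ) ≤ c :=
  le_trans (Nat.cast_le.2 (card_le_card (monotone_filter_right _ fun x _ => h x))) hQ

lemma card_filter_le_of_not {Ω : Type*} [Fintype Ω] {P : Ω → Prop} [DecidablePred P]
    {c : ℝ} (hc : 0 ≤ c) (h : ∀ x, ¬ P x) : ((univ.filter P).card : ℝ) ≤ c := by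
  simpa [filter_false_of_mem fun x _ => h x] using hc

lemma card_filter_prod_le_right {α β : Type*} [Fintype α] [Fintype β] (P : α × β → Prop)
    [DecidablePred P] (c : ℝ) (h : ∀ a, ((univ.filter fun b => P (a, b)).card : ℝ) ≤ c) :
    ((univ.filter P).card : ℝ) ≤ Fintype.card α * c := by
  rw [card_filter, Fintype.sum_prod_type]
  push_cast
  calc _ ≤ ∑ _a : α, c := sum_le_sum fun a _ => by
        have := h a
        rw [card_filter] at this
        exact_mod_cast this
    _ = _ := by simp

lemma card_filter_prod_le_left {α β : Type*} [Fintype α] [Fintype β] (P : α × β → Prop)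
    [DecidablePred P] (c : ℝ) (h : ∀ b, ((univ.filter fun a => P (a, b)).card : ℝ) ≤ c) :
    ((univ.filter P).card : ℝ) ≤ Fintype.card β * c := by
  rw [card_filter, Fintype.sum_prod_type_right]
  push_cast
  calc _ ≤ ∑ _b : β, c := sum_le_sum fun b _ => by
        have := h b
        rw [card_filter] at this
        exact_mod_cast this
    _ = _ := by simp

variable {V : Type*} [Fintype V] [DecidableEq V] {k : ℕ}

/-- The moment generating function of the number of coordinates that hit their targets. -/
lemma sum_exp_card_filter_le (hk : 0 < k) (W : Finset V) (i : V → Fin k) {τ : ℝ} (hτ : |τ| ≤ 1) :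
    ∑ x : V → Fin k, Real.exp (τ * (W.filter fun w => x w = i w).card) ≤
      (k : ℝ) ^ Fintype.card V * Real.exp (W.card * (τ + τ ^ 2) / k) := by
  have hk' : (0 : ℝ) < k := by exact_mod_cast hk
  have h1 : ∀ x : V → Fin k, Real.exp (τ * (W.filter fun w => x w = i w).card) =
      ∏ v, (if v ∈ W ∧ x v = i v then Real.exp τ else 1) := by
    intro x
    rw [prod_ite, prod_const_one, mul_one, prod_const, ← Real.exp_nat_mul, mul_comm]
    congr 4
    ext v
    simp
  have h2 : ∀ v, ∑ y : Fin k, (if v ∈ W ∧ y = i v then Real.exp τ else 1) ≤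
      k * (if v ∈ W then Real.exp ((τ + τ ^ 2) / k) else 1) := by
    intro v
    by_cases hv : v ∈ W
    · simp only [hv, true_and, if_true]
      have h3 : ∑ y : Fin k, (if y = i v then Real.exp τ else 1) = k + (Real.exp τ - 1) := by
        have : ∀ y : Fin k, (if y = i v then Real.exp τ else (1 : ℝ)) =
            1 + (if y = i v then Real.exp τ - 1 else 0) := by
          intro y
          split_ifs <;> ring
        simp [this, sum_add_distrib]
      rw [h3]
      -- This is exp τ - 1 ≤ τ + τ², and k + τ + τ² is then at most k exp((τ + τ²)/k).
      have h4 := (abs_le.1 (Real.abs_exp_sub_one_sub_id_le hτ)).2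
      have h5 := Real.add_one_le_exp ((τ + τ ^ 2) / k)
      have h6 := mul_le_mul_of_nonneg_left h5 hk'.le
      rw [mul_add, mul_div_cancel₀ _ hk'.ne'] at h6
      linarith
    · simp [hv]
  simp_rw [h1]
  have h7 := prod_univ_sum (fun _ : V => (univ : Finset (Fin k)))
    (fun v y => if v ∈ W ∧ y = i v then Real.exp τ else 1)
  rw [Fintype.piFinset_univ] at h7
  rw [← h7]
  calc _ ≤ ∏ v, (k * (if v ∈ W then Real.exp ((τ + τ ^ 2) / k) else 1) : ℝ) :=
        prod_le_prod (fun v _ => sum_nonneg fun y _ => by split_ifs <;> positivity)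
          fun v _ => h2 v
    _ = _ := by
      rw [prod_mul_distrib, prod_const, card_univ, prod_ite_mem, univ_inter, prod_const,
        ← Real.exp_nat_mul]
      congr 2
      ring

/-- A Chernoff bound for the number of coordinates that hit their targets. -/
lemma card_filter_le_exp (hk : 0 < k) (W : Finset V) (i : V → Fin k) {τ : ℝ} (hτ : |τ| ≤ 1)
    (β r : ℝ) (hr : W.card * (τ + τ ^ 2) / k - β ≤ r) (P : (V → Fin k) → Prop) [DecidablePred P]
    (hP : ∀ x, P x → β ≤ τ * (W.filter fun w => x w = i w).card) :
    ((univ.filter P).card : ℝ) ≤ (k : ℝ) ^ Fintype.card V * Real.exp r := by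
  -- Markov's inequality for exp(τ · hits): τ > 0 serves upper tails and τ < 0 lower tails.
  have h1 : ((univ.filter P).card : ℝ) * Real.exp β ≤
      ∑ x : V → Fin k, Real.exp (τ * (W.filter fun w => x w = i w).card) := by
    rw [← nsmul_eq_mul, ← sum_const]
    calc _ ≤ ∑ x ∈ univ.filter P, Real.exp (τ * (W.filter fun w => x w = i w).card) :=
          sum_le_sum fun x hx => Real.exp_le_exp.2 (hP x (mem_filter.1 hx).2)
      _ ≤ _ := sum_le_sum_of_subset_of_nonneg (filter_subset _ _) fun _ _ _ => (Real.exp_pos _).le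
  have h2 := h1.trans (sum_exp_card_filter_le hk W i hτ)
  rw [← le_div_iff₀ (Real.exp_pos β), mul_div_assoc, ← Real.exp_sub] at h2
  exact h2.trans (mul_le_mul_of_nonneg_left (Real.exp_le_exp.2 hr) (by positivity))

end Counting

/-! ### Probability of bad estimates. -/

section Votes

variable {V : Type} [Fintype V] [DecidableEq V] {G : SimpleGraph V} [DecidableRel G.Adj]
  {idBound : ℕ} (L : Labelling G idBound) {k m : ℕ}

/-- The nodes with random number zero. -/
def zeroSet (x : V → Fin k) (v : V) : Bool := decide ((x v).val = 0)

variable {L}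

lemma leaderRank_lt {lead : V → Bool} {w l : V} (hl : lead l = true) (hw : G.Adj w l) :
    L.leaderRank lead w l < ((G.neighborFinset w).filter fun v => lead v = true).card := by
  apply card_lt_card
  refine (Finset.ssubset_iff_of_subset ?_).2 ⟨l, ?_, ?_⟩
  · intro u hu
    rw [mem_filter] at hu ⊢
    exact ⟨hu.1, hu.2.1⟩
  · exact mem_filter.2 ⟨(G.mem_neighborFinset _ _).2 hw, hl⟩
  · simp

/-- With the leaders fixed, the votes for l are independent hits of fixed targets, the ranks of l.
By `hc` these ranks are below m on N(l), so the default target is never used there. -/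
lemma voteCount_eq (hm : 0 < m) {lead : V → Bool} {l : V} (hl : lead l = true)
    (hc : ∀ w, ((G.neighborFinset w).filter fun v => lead v = true).card ≤ m)
    (y : V → Fin m) (u : V) :
    L.voteCount lead (fun v => (y v).val) u l =
      ((G.neighborFinset u ∩ G.neighborFinset l).filter fun w =>
        y w = if h : L.leaderRank lead w l < m then ⟨_, h⟩ else ⟨0, hm⟩).card := by
  rw [Labelling.voteCount]
  congr 1
  ext w
  simp only [mem_filter, mem_inter, SimpleGraph.mem_neighborFinset, and_assoc]
  refine and_congr_right fun _ => ?_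
  rw [Labelling.Votes, G.adj_comm l w]
  refine and_congr_right fun hw => ?_
  rw [dif_pos ((leaderRank_lt hl hw).trans_le (hc w)), Fin.ext_iff]
  simp [hl, eq_comm]

/-- The exponent per leader in the error bound. -/
noncomputable def errorRate : ℝ := 1 / (32 * 324 ^ 2)

/-- The mean is at most 4q² / q = 4q. For twice that value, τ = 1/2 gives the exponent 3q - 4q = -q.
-/
lemma card_many_leaders_le {q : ℕ} (hq : 0 < q) (hΔ : G.maxDegree ≤ 4 * q ^ 2) (w : V) :
    ((univ.filter fun x : V → Fin q =>
      8 * q < ((G.neighborFinset w).filter fun v => zeroSet x v = true).card).card : ℝ) ≤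
      (q : ℝ) ^ Fintype.card V * Real.exp (-(errorRate * q)) := by
  have hq' : (0 : ℝ) < q := by exact_mod_cast hq
  have hW : ((G.neighborFinset w).card : ℝ) ≤ 4 * (q : ℝ) ^ 2 := by
    rw [G.card_neighborFinset_eq_degree]
    exact_mod_cast (G.degree_le_maxDegree w).trans hΔ
  refine card_filter_le_exp hq (G.neighborFinset w) (fun _ => ⟨0, hq⟩) (τ := 1 / 2)
    (by norm_num [abs_of_pos]) (4 * q) _ ?_ _ ?_
  · have : ((G.neighborFinset w).card : ℝ) * (1 / 2 + (1 / 2) ^ 2) / q ≤ 3 * q := by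
      rw [div_le_iff₀ hq']
      nlinarith
    rw [errorRate]
    linarith
  · intro x hx
    have h1 : (8 * q : ℝ) ≤
        ((G.neighborFinset w).filter fun v => zeroSet x v = true).card := by exact_mod_cast hx.le
    have h2 : ((G.neighborFinset w).filter fun v => zeroSet x v = true) =
        (G.neighborFinset w).filter fun v => x v = ⟨0, hq⟩ := by
      ext v
      simp [zeroSet, Fin.ext_iff]
    rw [h2] at h1
    linarith

/-- With τ = -1/2 and β = 0 the exponent is -|W|/(4q) ≤ -q/8. -/
lemma card_no_leader_le {q : ℕ} (hq : 0 < q) (W : Finset V) (hW : q ^ 2 ≤ 2 * W.card) :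
    ((univ.filter fun x : V → Fin q => ∀ v ∈ W, ¬ zeroSet x v = true).card : ℝ) ≤
      (q : ℝ) ^ Fintype.card V * Real.exp (-(errorRate * q)) := by
  have hq' : (0 : ℝ) < q := by exact_mod_cast hq
  have hW' : (q : ℝ) ^ 2 ≤ 2 * W.card := by exact_mod_cast hW
  refine card_filter_le_exp hq W (fun _ => ⟨0, hq⟩) (τ := -(1 / 2))
    (by norm_num [abs_of_pos]) 0 _ ?_ _ ?_
  · have : (W.card : ℝ) * (-(1 / 2) + (-(1 / 2)) ^ 2) / q ≤ -(1 / 8) * q := by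
      rw [div_le_iff₀ hq']
      nlinarith
    rw [errorRate]
    linarith
  · intro x hx
    have h2 : (W.filter fun v => x v = ⟨0, hq⟩) = ∅ := by
      refine filter_eq_empty_iff.2 fun v hv h0 => hx v hv ?_
      simp [zeroSet, h0]
    simp [h2]

/-- The left side is at most Δ(τ² - |τ|/324)/(8q), which is smallest at |τ| = 1/648. There Δ ≥ q²
gives -q/(8 · 648²), which determines `errorRate`. -/
lemma vote_exponent_le {q N Δ τ : ℝ} (hq : 0 < q) (hNΔ : N ≤ Δ) (hqΔ : q ^ 2 ≤ Δ)
    (hτ : |τ| = 1 / 648) :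
    N * (τ + τ ^ 2) / (8 * q) - (τ * N + Δ / (648 * 324)) / (8 * q) ≤ -(errorRate * q) := by
  have h2 : τ ^ 2 = 1 / 648 ^ 2 := by
    rw [← sq_abs, hτ]
    norm_num
  rw [← sub_div, div_le_iff₀ (by positivity), h2, errorRate]
  nlinarith

lemma card_bad_votes_le {q : ℕ} (hq : 0 < q) (hΔ : q ^ 2 ≤ G.maxDegree)
    {lead : V → Bool} {l : V} (hl : lead l = true)
    (hc : ∀ w, ((G.neighborFinset w).filter fun v => lead v = true).card ≤ 8 * q) (u : V) :
    ((univ.filter fun y : V → Fin (8 * q) => 324 * codeg G u l + G.maxDegree <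
        324 * (8 * q * L.voteCount lead (fun v => (y v).val) u l)).card : ℝ) ≤
      ((8 * q : ℕ) : ℝ) ^ Fintype.card V * Real.exp (-(errorRate * q)) ∧
    ((univ.filter fun y : V → Fin (8 * q) =>
        324 * (8 * q * L.voteCount lead (fun v => (y v).val) u l) + G.maxDegree <
          324 * codeg G u l).card : ℝ) ≤
      ((8 * q : ℕ) : ℝ) ^ Fintype.card V * Real.exp (-(errorRate * q)) := by
  have hm : 0 < 8 * q := by omega
  have hq' : (0 : ℝ) < q := by exact_mod_cast hq
  have hΔ' : (q : ℝ) ^ 2 ≤ G.maxDegree := by exact_mod_cast hΔ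
  have hN : (codeg G u l : ℝ) ≤ G.maxDegree := by exact_mod_cast codeg_le_maxDegree u l
  have hcast : ((8 * q : ℕ) : ℝ) = 8 * q := by push_cast; ring
  constructor
  · refine card_filter_le_exp hm (G.neighborFinset u ∩ G.neighborFinset l)
      (fun w => if h : L.leaderRank lead w l < 8 * q then ⟨_, h⟩ else ⟨0, hm⟩) (τ := 1 / 648)
      (by norm_num [abs_of_pos])
      ((1 / 648 * codeg G u l + G.maxDegree / (648 * 324)) / (8 * q)) _ ?_ _ ?_
    · rw [hcast]
      exact vote_exponent_le hq' hN hΔ' (by norm_num [abs_of_pos])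
    · intro y hy
      rw [← voteCount_eq hm hl hc y u]
      have hy' : (324 * codeg G u l + G.maxDegree : ℝ) ≤
        324 * (8 * q * L.voteCount lead (fun v => (y v).val) u l) := by exact_mod_cast hy.le
      rw [div_le_iff₀ (by positivity)]
      linarith
  · refine card_filter_le_exp hm (G.neighborFinset u ∩ G.neighborFinset l)
      (fun w => if h : L.leaderRank lead w l < 8 * q then ⟨_, h⟩ else ⟨0, hm⟩) (τ := -(1 / 648))
      (by norm_num [abs_of_pos])
      ((-(1 / 648) * codeg G u l + G.maxDegree / (648 * 324)) / (8 * q)) _ ?_ _ ?_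
    · rw [hcast]
      exact vote_exponent_le hq' hN hΔ' (by norm_num [abs_of_pos])
    · intro y hy
      rw [← voteCount_eq hm hl hc y u]
      have hy' : (324 * (8 * q * L.voteCount lead (fun v => (y v).val) u l) + G.maxDegree : ℝ) ≤
        324 * codeg G u l := by exact_mod_cast hy.le
      rw [div_le_iff₀ (by positivity)]
      linarith

lemma card_filter_prod_le_of_fst {q : ℕ} (P : (V → Fin q) × (V → Fin (8 * q)) → Prop)
    (Q : (V → Fin q) → Prop) [DecidablePred P] [DecidablePred Q] {r : ℝ}
    (hQ : ((univ.filter Q).card : ℝ) ≤ (q : ℝ) ^ Fintype.card V * r) (h : ∀ x, P x → Q x.1) :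
    ((univ.filter P).card : ℝ) ≤ Fintype.card ((V → Fin q) × (V → Fin (8 * q))) * r := by
  have h1 := card_filter_prod_le_left P _ fun b =>
    card_filter_le_of_imp (P := fun a => P (a, b)) hQ fun a => h (a, b)
  refine h1.trans_eq ?_
  rw [Fintype.card_prod, Fintype.card_fun (α := V) (β := Fin q), Fintype.card_fin]
  push_cast
  ring

lemma card_filter_prod_le_of_snd {q : ℕ} (P : (V → Fin q) × (V → Fin (8 * q)) → Prop)
    [DecidablePred P] {r : ℝ}
    (h : ∀ x, ((univ.filter fun y => P (x, y)).card : ℝ) ≤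
      ((8 * q : ℕ) : ℝ) ^ Fintype.card V * r) :
    ((univ.filter P).card : ℝ) ≤ Fintype.card ((V → Fin q) × (V → Fin (8 * q))) * r := by
  refine (card_filter_prod_le_right P _ h).trans_eq ?_
  rw [Fintype.card_prod, Fintype.card_fun (α := V) (β := Fin (8 * q)), Fintype.card_fin]
  push_cast
  ring

/-- No node has more than `8 * q` leaders among its neighbours. -/
def FewLeaders (G : SimpleGraph V) [DecidableRel G.Adj] {q : ℕ} (x : V → Fin q) : Prop :=
  ∀ w, ((G.neighborFinset w).filter fun v => zeroSet x v = true).card ≤ 8 * q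

/-- The estimate of the number of common neighbours of `u` and `l`. -/
def pairEst (L : Labelling G idBound) {q : ℕ} (x : (V → Fin q) × (V → Fin (8 * q)))
    (u l : V) : ℕ :=
  8 * q * L.voteCount (zeroSet x.1) (fun v => (x.2 v).val) u l

/-- The events that spoil the estimates: too many leaders at a node, no leader among the friends
of a dense node, and an estimate that is too large or too small. -/
def BadEvent (L : Labelling G idBound) {q : ℕ} :
    (V ⊕ V) ⊕ (V × V) ⊕ (V × V) → (V → Fin q) × (V → Fin (8 * q)) → Prop
  | .inl (.inl w), x =>
    8 * q < ((G.neighborFinset w).filter fun v => zeroSet x.1 v = true).card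
  | .inl (.inr u), x =>
    IsDense G (1 / 3 / 108) u ∧ ∀ v, IsFriend G (1 / 3 / 108) u v → ¬ zeroSet x.1 v = true
  | .inr (.inl (u, l)), x => (FewLeaders G x.1 ∧ zeroSet x.1 l = true) ∧
    324 * codeg G u l + G.maxDegree < 324 * pairEst L x u l
  | .inr (.inr (u, l)), x => (FewLeaders G x.1 ∧ zeroSet x.1 l = true) ∧
    324 * pairEst L x u l + G.maxDegree < 324 * codeg G u l

lemma goodEstimates_of_not_badEvent {q : ℕ} {x : (V → Fin q) × (V → Fin (8 * q))}
    (h : ∀ i, ¬ BadEvent L i x) :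
    GoodEstimates G (fun v => zeroSet x.1 v = true) (pairEst L x) := by
  have hfew : FewLeaders G x.1 := fun w => not_lt.1 (h (.inl (.inl w)))
  refine ⟨fun u l hl => ?_, fun u l hl => ?_, fun u hu => ?_⟩
  · exact not_lt.1 fun hlt => h (.inr (.inl (u, l))) ⟨⟨hfew, hl⟩, hlt⟩
  · exact not_lt.1 fun hlt => h (.inr (.inr (u, l))) ⟨⟨hfew, hl⟩, hlt⟩
  · by_contra! hno
    exact h (.inl (.inr u)) ⟨hu, hno⟩

-- The first two kinds of events involve only the leader choices. The others are bounded for each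
-- fixed leader choice; they include `FewLeaders` because the ranks must be possible vote indices.
open Classical in
lemma card_badEvent_le {q : ℕ} (hq : 0 < q) (hΔ : q ^ 2 ≤ G.maxDegree)
    (hΔ' : G.maxDegree ≤ 4 * q ^ 2) (i : (V ⊕ V) ⊕ (V × V) ⊕ (V × V)) :
    ((univ.filter (BadEvent L (q := q) i)).card : ℝ) ≤
      Fintype.card ((V → Fin q) × (V → Fin (8 * q))) * Real.exp (-(errorRate * q)) := by
  rcases i with ((w | u) | (⟨u, l⟩ | ⟨u, l⟩))
  · exact card_filter_prod_le_of_fst _ _ (card_many_leaders_le hq hΔ' w) fun x hx => hx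
  · by_cases hu : IsDense G (1 / 3 / 108) u
    · refine card_filter_prod_le_of_fst _ _ (card_no_leader_le hq
        (univ.filter fun v => IsFriend G (1 / 3 / 108) u v) ?_)
        fun x hx v hv => hx.2 v (mem_filter.1 hv).2
      have := isDense_iff_card.1 hu
      omega
    · exact card_filter_le_of_not (by positivity) fun x hx => hu hx.1
  · refine card_filter_prod_le_of_snd _ fun x => ?_
    by_cases hx : FewLeaders G x ∧ zeroSet x l = true
    · exact card_filter_le_of_imp (card_bad_votes_le (L := L) hq hΔ hx.2 hx.1 u).1
        fun y hy => hy.2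
    · exact card_filter_le_of_not (by positivity) fun y hy => hx hy.1
  · refine card_filter_prod_le_of_snd _ fun x => ?_
    by_cases hx : FewLeaders G x ∧ zeroSet x l = true
    · exact card_filter_le_of_imp (card_bad_votes_le (L := L) hq hΔ hx.2 hx.1 u).2
        fun y hy => hy.2
    · exact card_filter_le_of_not (by positivity) fun y hy => hx hy.1

open Classical in
/-- Few pairs of leader choices and vote indices give bad estimates. -/
theorem card_not_goodEstimates_le {q : ℕ} (hq : 0 < q) (hΔ : q ^ 2 ≤ G.maxDegree)
    (hΔ' : G.maxDegree ≤ 4 * q ^ 2) :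
    ((univ.filter fun x : (V → Fin q) × (V → Fin (8 * q)) =>
      ¬ GoodEstimates G (fun v => zeroSet x.1 v = true) (pairEst L x)).card : ℝ) ≤
      (2 * Fintype.card V + 2 * Fintype.card V ^ 2) *
        (Fintype.card ((V → Fin q) × (V → Fin (8 * q))) * Real.exp (-(errorRate * q))) := by
  have hcard : (Fintype.card ((V ⊕ V) ⊕ (V × V) ⊕ (V × V)) : ℝ) =
      2 * Fintype.card V + 2 * Fintype.card V ^ 2 := by
    simp only [Fintype.card_sum, Fintype.card_prod]
    push_cast
    ring
  rw [← hcard]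
  refine card_filter_le_of_forall_exists _ (BadEvent L) _ (card_badEvent_le hq hΔ hΔ') ?_
  intro x hx
  by_contra! hn
  exact hx (goodEstimates_of_not_badEvent hn)

end Votes

/-! ### Failure probability of the algorithm. -/

section Main

variable {a : ℕ} {V : Type} [Fintype V] [DecidableEq V] {G : SimpleGraph V} [DecidableRel G.Adj]
  (L : Labelling G (Fintype.card V ^ a))

/-- The random bits of all nodes as leader choices and vote indices. -/
noncomputable def coinsEquiv :
    (voteAlgorithm a).Coins G ≃
      (V → Fin (2 ^ leadBits G.maxDegree)) × (V → Fin (8 * 2 ^ leadBits G.maxDegree)) :=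
  (Equiv.piCongrRight fun _ => (bitsEquiv (leadBits G.maxDegree)).trans
    ((Equiv.refl _).prodCongr (finCongr (by ring)))).trans
    (Equiv.arrowProdEquivProdArrow _ _ _)

lemma goodEstimates_iff_coinsEquiv (ω : (voteAlgorithm a).Coins G) :
    GoodEstimates G (fun v => leaders a ω v = true) (voteEst L ω) ↔
      GoodEstimates G (fun v => zeroSet (coinsEquiv ω).1 v = true)
        (pairEst L (coinsEquiv ω)) := by
  have h : numIdx G.maxDegree = 8 * 2 ^ leadBits G.maxDegree := by
    rw [numIdx]
    ring
  unfold voteEst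
  rw [h]
  rfl

lemma sq_two_pow_leadBits {Δ : ℕ} (hΔ : 0 < Δ) :
    (2 ^ leadBits Δ) ^ 2 ≤ Δ ∧ Δ ≤ 4 * (2 ^ leadBits Δ) ^ 2 := by
  have h : (2 ^ leadBits Δ) ^ 2 = 4 ^ leadBits Δ := by
    rw [← pow_mul, mul_comm, pow_mul]
    norm_num
  rw [h]
  refine ⟨Nat.pow_log_le_self 4 hΔ.ne', ?_⟩
  have := Nat.lt_pow_succ_log_self (b := 4) (by norm_num) Δ
  rw [pow_succ] at this
  unfold leadBits
  omega

lemma uniformOn_real_eq {Ω : Type*} [Fintype Ω] [MeasurableSpace Ω] [MeasurableSingletonClass Ω]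
    (P : Ω → Prop) [DecidablePred P] :
    (ProbabilityTheory.uniformOn (Set.univ : Set Ω)).real {x | P x} =
      ((univ.filter P).card : ℝ) / Fintype.card Ω := by
  have h : {x | P x} = ((univ.filter P : Finset Ω) : Set Ω) := by
    ext
    simp
  rw [MeasureTheory.measureReal_def, ProbabilityTheory.uniformOn_univ, h,
    MeasureTheory.Measure.count_apply_finset]
  simp

open Classical in
/-- The failure probability of the algorithm. -/
theorem one_sub_le_outputProb (hΔ : 0 < G.maxDegree) :
    1 - (2 * Fintype.card V + 2 * Fintype.card V ^ 2) *
        Real.exp (-(errorRate * (2 ^ leadBits G.maxDegree : ℕ))) ≤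
      (voteAlgorithm a).outputProb L 5 (OutputsACD G (1 / 3) (1 / 3 / 108)) := by
  set q : ℕ := 2 ^ leadBits G.maxDegree with hq
  have h1 := card_not_goodEstimates_le (L := L) (q := q) (by positivity)
    (sq_two_pow_leadBits hΔ).1 (sq_two_pow_leadBits hΔ).2
  set N := Fintype.card ((voteAlgorithm a).Coins G)
  have hN : Fintype.card ((V → Fin q) × (V → Fin (8 * q))) = N :=
    (Fintype.card_congr coinsEquiv).symm
  have hNpos : (0 : ℝ) < N := by
    exact_mod_cast Fintype.card_pos
  set good : (voteAlgorithm a).Coins G → Prop := fun ω =>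
    GoodEstimates G (fun v => leaders a ω v = true) (voteEst L ω) with hgood
  have h2 : (univ.filter fun ω => ¬ good ω).card =
      (univ.filter fun x : (V → Fin q) × (V → Fin (8 * q)) =>
      ¬ GoodEstimates G (fun v => zeroSet x.1 v = true) (pairEst L x)).card := by
    refine card_equiv coinsEquiv fun ω => ?_
    simp only [mem_filter, mem_univ, true_and]
    exact not_congr (goodEstimates_iff_coinsEquiv L ω)
  rw [← h2, hN] at h1
  have h3 : (univ.filter good).card + (univ.filter fun ω => ¬ good ω).card = N := by
    rw [card_filter_add_card_filter_not, card_univ]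
  have h4 : ((univ.filter good).card : ℝ) + (univ.filter fun ω => ¬ good ω).card = N := by
    exact_mod_cast h3
  rw [DistAlgorithm.outputProb, uniformOn_real_eq, le_div_iff₀ hNpos]
  have h5 : ((univ.filter good).card : ℝ) ≤ (univ.filter fun ω => OutputsACD G (1 / 3) (1 / 3 / 108)
      fun v => (voteAlgorithm a).output ((voteAlgorithm a).run L ω 5 v)).card :=
    Nat.cast_le.2 (card_le_card (monotone_filter_right _ fun ω _ hω =>
      outputsACD_of_goodEstimates hΔ hω))
  refine le_trans ?_ h5
  linarith

/-- The choice of c gives `errorRate` · q ≥ (κ + 4) log n. The four extra powers of n pay for the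
union bound, as 2n + 2n² ≤ n⁴ for n ≥ 2. -/
lemma failure_bound {n q κ c : ℝ} (hn : 2 ≤ n) (hq : 0 ≤ q) (hκ : 1 ≤ κ)
    (hc : c = (2 * (κ + 4) / errorRate) ^ 2) (h : c * Real.log n ^ 2 ≤ 4 * q ^ 2) :
    (2 * n + 2 * n ^ 2) * Real.exp (-(errorRate * q)) ≤ n ^ (-κ) := by
  have hr : 0 < errorRate := by
    rw [errorRate]
    norm_num
  have hn0 : 0 < n := by linarith
  have hlog : 0 ≤ Real.log n := Real.log_nonneg (by linarith)
  have h1 : (2 * (κ + 4) / errorRate) * Real.log n ≤ 2 * q := by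
    refine le_of_sq_le_sq ?_ (by positivity)
    rw [mul_pow, ← hc]
    linarith
  have h2 : (κ + 4) * Real.log n ≤ errorRate * q := by
    rw [div_mul_eq_mul_div, div_le_iff₀ hr] at h1
    linarith
  have h3 : Real.exp (-(errorRate * q)) ≤ n ^ (-κ) * (n ^ 4)⁻¹ := by
    have : n ^ (-κ) * (n ^ 4)⁻¹ = Real.exp (-((κ + 4) * Real.log n)) := by
      rw [Real.rpow_def_of_pos hn0, ← Real.exp_log (pow_pos hn0 4), ← Real.exp_neg,
        ← Real.exp_add, Real.log_pow]
      congr 1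
      push_cast
      ring
    rw [this]
    exact Real.exp_le_exp.2 (by linarith)
  have h4 : 2 * n + 2 * n ^ 2 ≤ n ^ 4 := by
    have : 0 ≤ n ^ 2 * (n ^ 2 - 4) + n * (n - 2) * 2 := by
      have : 0 ≤ n ^ 2 - 4 := by nlinarith
      have : 0 ≤ n - 2 := by linarith
      positivity
    nlinarith
  calc (2 * n + 2 * n ^ 2) * Real.exp (-(errorRate * q)) ≤ n ^ 4 * (n ^ (-κ) * (n ^ 4)⁻¹) := by
        gcongr
    _ = n ^ (-κ) := by
        field_simp

end Main

theorem mainTheorem6 :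
    ∃ T : ℕ, ∀ a : ℕ, ∃ (A : DistAlgorithm) (B : ℕ), A.IsCongest T a B ∧
      ∀ κ : ℝ, 1 ≤ κ → ∃ c : ℝ, 0 < c ∧
        ∀ (V : Type) [Fintype V] [DecidableEq V] (G : SimpleGraph V) [DecidableRel G.Adj]
          (L : Labelling G (Fintype.card V ^ a)),
          c * Real.log (Fintype.card V) ^ 2 ≤ (G.maxDegree : ℝ) →
          1 - (Fintype.card V : ℝ) ^ (-κ) ≤
            A.outputProb L T (OutputsACD G (1 / 3) (1 / 3 / 108)) := by
  refine ⟨5, fun a => ⟨voteAlgorithm a, a + 1, isCongest_voteAlgorithm a 5, fun κ hκ =>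
    ⟨(2 * (κ + 4) / errorRate) ^ 2, ?_, ?_⟩⟩⟩
  · have : 0 < errorRate := by
      rw [errorRate]
      norm_num
    positivity
  intro V _ _ G _ L h
  -- Here log n may vanish and Δ may be 0. For n = 0 the empty decomposition works, and for n = 1
  -- the claimed probability is 0. For n ≥ 2 the hypothesis forces Δ > 0.
  rcases Nat.lt_or_ge (Fintype.card V) 2 with hn | hn
  · rcases Nat.eq_zero_or_pos (Fintype.card V) with h0 | h0
    · have hV : IsEmpty V := Fintype.card_eq_zero_iff.1 h0
      have hall : ∀ out : V → Option ℕ, OutputsACD G (1 / 3) (1 / 3 / 108) out := fun out =>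
        ⟨∅, 0, Fin.elim0, Fin.elim0, ⟨isEmptyElim, fun i => i.elim0, fun i => i.elim0, isEmptyElim,
          fun i => i.elim0, fun i => i.elim0, fun i => i.elim0⟩, fun i => i.elim0, isEmptyElim,
          fun i => i.elim0⟩
      classical
      rw [DistAlgorithm.outputProb, uniformOn_real_eq]
      simp only [hall, filter_true, card_univ]
      rw [div_self (by exact_mod_cast Fintype.card_ne_zero)]
      linarith [Real.rpow_nonneg (Nat.cast_nonneg (α := ℝ) (Fintype.card V)) (-κ)]
    · have h1 : Fintype.card V = 1 := by omega
      have h2 : (1 : ℝ) - (Fintype.card V : ℝ) ^ (-κ) = 0 := by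
        rw [h1, Nat.cast_one, Real.one_rpow, sub_self]
      exact h2.le.trans MeasureTheory.measureReal_nonneg
  · have hn' : (2 : ℝ) ≤ Fintype.card V := by exact_mod_cast hn
    have hΔ : 0 < G.maxDegree := by
      have : 0 < errorRate := by
        rw [errorRate]
        norm_num
      have hlog : 0 < Real.log (Fintype.card V) := Real.log_pos (by linarith)
      have : (0 : ℝ) < G.maxDegree := lt_of_lt_of_le (by positivity) h
      exact_mod_cast this
    refine le_trans ?_ (one_sub_le_outputProb L hΔ)
    have h4 : (G.maxDegree : ℝ) ≤ 4 * ((2 ^ leadBits G.maxDegree : ℕ) : ℝ) ^ 2 := by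
      exact_mod_cast (sq_two_pow_leadBits hΔ).2
    have := failure_bound hn' (Nat.cast_nonneg _) hκ rfl (h.trans h4)
    linarith
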